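/- Let $n \ge 3$ and let $P_n = \{P \in M_n(\mathbb{C}) : P^2 = P = P^*\}$ be the set of all $n\times n$ complex (orthogonal) projections. Let $\phi : P_n \to P_n$ be a bijective map such that for every pair $P, Q \in P_n$ $$PQ = QP \iff \phi(P)\phi(Q) = \phi(Q)\phi(P).$$ Then there exists an $n\times n$ unitary matrix $U$ such that either $$\phi(\{P, I-P\}) = \{UPU^*,\, I - UPU^*\} \quad \text{for all } P \in P_n,$$ or $$\phi(\{P, I-P\}) = \{UP^tU^*,\, I - UP^tU^*\} \quad \text{for all } P \in P_n,$$ where $\phi(\{P, I-P\})$ denotes the image $\{\phi(P), \phi(I-P)\}$ and $P^t$ is the transpose of $P$. -/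

import Mathlib

open scoped Matrix

/-- The set `P_n` of all `n × n` projections: complex matrices `P` with `P² = P = P*`. -/
abbrev ProjMat (n : ℕ) : Type :=
  {P : Matrix (Fin n) (Fin n) ℂ // P * P = P ∧ Pᴴ = P}

/-- The projection `I - P`. -/
def ProjMat.compl {n : ℕ} (P : ProjMat n) : ProjMat n :=
  ⟨1 - P.1, by
    refine ⟨?_, ?_⟩
    · rw [mul_sub, sub_mul, sub_mul, P.2.1]
      simp
    · rw [Matrix.conjTranspose_sub, Matrix.conjTranspose_one, P.2.2]⟩

/-! Commutativity alone determines which noncentral projections have rank or corank one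
(`not_isThick_ofVec`, `exists_ofVec_of_not_isThick`). It cannot see the difference between `P` and
`I - P`, so `φ` induces a map `F` on lines characterised by commutants only. For `n ≥ 3`, two lines
are orthogonal exactly when their projections commute and have different commutants
(`orthogonal_iff_comm`), so `F` preserves orthogonality in both directions (`exists_lineMap`).

Uhlhorn's theorem (`exists_unitary_of_preserves_orthogonality`) then makes `F` unitary or
antiunitary up to scalars. Conjugating by that operator gives a map `g` such that `φ P` and `g P`
commute with the same rank-one projections. By `eq_of_comm_ofVec` they agree up to complement, and
injectivity of `φ` turns this into equality of pairs (`image_pair_eq`). The antiunitary case yields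
the transpose, which for a Hermitian matrix is the entrywise conjugate. -/

/-! ### Scalar functional equations over ℂ. -/

/-- Commuting with conjugation forces real values on ℝ, and the only ring endomorphism of ℝ is the
identity; hence `h` is ℝ-linear. -/
theorem Complex.ringHom_eq_id_or_conj_of_commute_star (h : ℂ →+* ℂ)
    (hs : ∀ z, h (star z) = star (h z)) :
    h = RingHom.id ℂ ∨ h = starRingEnd ℂ := by
  have hreal : ∀ r : ℝ, h (r : ℂ) = ((h (r : ℂ)).re : ℂ) := by
    intro r
    have h1 := hs (r : ℂ)
    rw [Complex.star_def, Complex.conj_ofReal] at h1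
    exact (Complex.conj_eq_iff_re.mp h1.symm).symm
  let g : ℝ →+* ℝ :=
    { toFun := fun r => (h (r : ℂ)).re
      map_zero' := by simp
      map_one' := by simp
      map_add' := fun x y => by simp
      map_mul' := fun x y => by
        have := congrArg Complex.re (map_mul h (x : ℂ) (y : ℂ))
        rw [hreal x, hreal y, ← Complex.ofReal_mul, ← Complex.ofReal_mul,
          Complex.ofReal_re] at this
        exact this }
  have hg : ∀ r : ℝ, h (r : ℂ) = r := by
    intro r
    rw [hreal r]
    have : g r = r := by rw [Subsingleton.elim g (RingHom.id ℝ)]; rfl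
    exact congrArg Complex.ofReal this
  let A : ℂ →ₐ[ℝ] ℂ := { h with commutes' := fun r => hg r }
  rcases Complex.real_algHom_eq_id_or_conj A with hA | hA
  · left; ext z; exact DFunLike.congr_fun hA z
  · right; ext z; exact DFunLike.congr_fun hA z

/-- A pair of proportional coordinate maps preserving the orthogonality of vectors with first
coordinate `1` comes from a ring homomorphism commuting with conjugation. -/
theorem exists_ringHom_of_orthogonality_preserving (σ τ : ℂ → ℂ) (κ : ℂ)
    (hσ0 : σ 0 = 0) (hτ0 : τ 0 = 0) (hκ : ∀ a, σ a = κ * τ a)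
    (H : ∀ a b c d : ℂ, 1 + star a * c + star b * d = 0 →
      1 + star (σ a) * σ c + star (τ b) * τ d = 0) :
    ∃ h : ℂ →+* ℂ, (∀ z, h (star z) = star (h z)) ∧ (∀ a, σ a = σ 1 * h a) ∧
      star (σ 1) * σ 1 = 1 := by
  have H1 : ∀ a c, star a * c = -1 → star (σ a) * σ c = -1 := by
    intro a c hac
    have := H a 0 c 0 (by rw [hac]; simp)
    rw [hτ0] at this
    linear_combination this
  have H2 : ∀ a c, star a * c = -1 → star (τ a) * τ c = -1 := by
    intro a c hac
    have := H 0 a 0 c (by rw [hac]; simp)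
    rw [hσ0] at this
    linear_combination this
  -- the products only depend on `star a * c`
  have P1 : ∀ a c, star (σ a) * σ c = star (σ 1) * σ (star a * c) := by
    intro a c
    -- The last coordinates are the same in both instances, so subtraction cancels the `τ` terms.
    have e1 := H a 1 c (-1 - star a * c) (by rw [star_one]; ring)
    have e2 := H 1 1 (star a * c) (-1 - star a * c) (by rw [star_one]; ring)
    linear_combination e1 - e2
  have P2 : ∀ a c, star (τ a) * τ c = star (τ 1) * τ (star a * c) := by
    intro a c
    have e1 := H 1 a (-1 - star a * c) c (by rw [star_one]; ring)
    have e2 := H 1 1 (-1 - star a * c) (star a * c) (by rw [star_one]; ring)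
    linear_combination e1 - e2
  have key : ∀ ρ : ℂ → ℂ, (∀ a c, star a * c = -1 → star (ρ a) * ρ c = -1) →
      (∀ a c, star (ρ a) * ρ c = star (ρ 1) * ρ (star a * c)) →
      star (ρ 1) * ρ 1 = 1 ∧ ρ (-1) = - ρ 1 := by
    intro ρ h1 h2
    have a1 : star (ρ (-1)) * ρ (-1) = star (ρ 1) * ρ 1 := by simpa using h2 (-1) (-1)
    have a2 : star (ρ 1) * ρ (-1) = -1 := h1 _ _ (by simp)
    have a3 : star (ρ (-1)) * ρ 1 = -1 := h1 _ _ (by simp)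
    have a4 : (star (ρ 1) * ρ 1) * (star (ρ 1) * ρ 1) = 1 := by
      linear_combination (star (ρ (-1)) * ρ 1) * a2 - a3 - (star (ρ 1) * ρ 1) * a1
    have a5 : star (ρ 1) * ρ 1 = 1 := by
      have e : star (ρ 1) * ρ 1 = ((Complex.normSq (ρ 1) : ℝ) : ℂ) := by
        rw [Complex.star_def, mul_comm, Complex.mul_conj]
      rw [e] at a4 ⊢
      norm_cast at a4 ⊢
      have := Complex.normSq_nonneg (ρ 1)
      nlinarith
    refine ⟨a5, ?_⟩
    linear_combination ρ 1 * a2 - ρ (-1) * a5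
  obtain ⟨u1, um⟩ := key σ H1 P1
  obtain ⟨v1, vm⟩ := key τ H2 P2
  -- A unimodular `κ` makes `σ` and `τ` yield the same normalised map `h`.
  have hk : star κ * κ = 1 := by
    have := hκ 1
    rw [this, star_mul'] at u1
    linear_combination u1 - star κ * κ * v1
  let h : ℂ → ℂ := fun a => star (σ 1) * σ a
  have hτ : ∀ a, star (τ 1) * τ a = h a := by
    intro a
    simp only [h]
    rw [hκ 1, hκ a, star_mul']
    linear_combination - (star (τ 1) * τ a) * hk
  have hstar : ∀ z, h (star z) = star (h z) := by
    intro z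
    have := P1 z 1
    simp only [h, star_mul', star_star]
    rw [mul_one] at this
    rw [← this]; ring
  have hσ : ∀ a, σ a = σ 1 * h a := by
    intro a; simp only [h]; linear_combination - σ a * u1
  have hmul : ∀ a b, h (a * b) = h a * h b := by
    intro a b
    have := P1 (star a) b
    rw [star_star] at this
    have e : h (a * b) = star (σ (star a)) * σ b := this.symm
    rw [e, hσ (star a), hstar, star_mul', star_star]
    simp only [h]; ring
  have hone : h 1 = 1 := u1
  have hneg : ∀ a, h (-a) = - h a := by
    intro a
    have e : h (-1) = -1 := by
      simp only [h]; rw [um]; linear_combination -u1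
    rw [← neg_one_mul, hmul, e]; ring
  have hsucc : ∀ t, h (1 + t) = 1 + h t := by
    intro t
    -- Orthogonality of `(1, 1, 1)` and `(1, t, -(1 + t))` encodes addition; multiplicativity
    -- extends it to all sums.
    have := H 1 1 t (-(1 + t)) (by rw [star_one]; ring)
    have e1 : star (τ 1) * τ (-(1 + t)) = - h (1 + t) := by rw [hτ, hneg]
    have e2 : star (σ 1) * σ t = h t := rfl
    rw [e1, e2] at this
    linear_combination -this
  have hzero : h 0 = 0 := by simp [h, hσ0]
  have hadd : ∀ a b, h (a + b) = h a + h b := by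
    intro a b
    by_cases ha : a = 0
    · simp [ha, hzero]
    · have e : a + b = a * (1 + a⁻¹ * b) := by field_simp
      have e' : b = a * (a⁻¹ * b) := by field_simp
      rw [e, hmul, hsucc]
      conv_rhs => rw [e', hmul]
      ring
  exact ⟨{ toFun := h, map_one' := hone, map_mul' := hmul, map_zero' := hzero, map_add' := hadd },
    hstar, hσ, u1⟩

/-! ### Uhlhorn's theorem in coordinates. -/

section Uhlhorn

variable {ι : Type*} [Fintype ι]

open scoped ComplexOrder in
theorem Complex.star_dotProduct_self_eq_zero {v : ι → ℂ} : star v ⬝ᵥ v = 0 ↔ v = 0 :=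
  dotProduct_star_self_eq_zero

theorem star_dotProduct_comm (v w : ι → ℂ) : star (star v ⬝ᵥ w) = star w ⬝ᵥ v := by
  rw [Matrix.star_dotProduct, star_star]

theorem star_dotProduct_eq_pair [DecidableEq ι] {v w : ι → ℂ} {i j : ι} (hij : i ≠ j)
    (h : ∀ k, k ≠ i → k ≠ j → v k = 0) :
    star v ⬝ᵥ w = star (v i) * w i + star (v j) * w j := by
  rw [dotProduct, ← Finset.sum_pair (f := fun k => star (v k) * w k) hij]
  refine (Finset.sum_subset (Finset.subset_univ _) fun k _ hk => ?_).symm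
  simp only [Finset.mem_insert, Finset.mem_singleton, not_or] at hk
  simp [h k hk.1 hk.2]

theorem star_dotProduct_eq_triple [DecidableEq ι] {v w : ι → ℂ} {i j k : ι} (hij : i ≠ j) (hik : i ≠ k)
    (hjk : j ≠ k) (h : ∀ l, l ≠ i → l ≠ j → l ≠ k → v l = 0) :
    star v ⬝ᵥ w = star (v i) * w i + star (v j) * w j + star (v k) * w k := by
  have e : ∑ l ∈ {i, j, k}, star (v l) * w l =
      star (v i) * w i + star (v j) * w j + star (v k) * w k := by
    rw [Finset.sum_insert (by simp [hij, hik]), Finset.sum_pair hjk]; ring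
  rw [dotProduct, ← e]
  refine (Finset.sum_subset (Finset.subset_univ _) fun l _ hl => ?_).symm
  simp only [Finset.mem_insert, Finset.mem_singleton, not_or] at hl
  simp [h l hl.1 hl.2.1 hl.2.2]

theorem star_dotProduct_comp_ringHom (h : ℂ →+* ℂ) (hs : ∀ z, h (star z) = star (h z))
    (x y : ι → ℂ) : star (fun i => h (x i)) ⬝ᵥ (fun i => h (y i)) = h (star x ⬝ᵥ y) := by
  simp [dotProduct, map_sum, ← hs]

/-- A map which preserves orthogonality and the vanishing of each coordinate is, up to scalars,
a diagonal unitary composed with a coordinatewise ring homomorphism. -/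
theorem exists_diagonal_of_preserves_orthogonality [DecidableEq ι] (i₀ : ι)
    (hcard : ∀ j, j ≠ i₀ → ∃ k, k ≠ i₀ ∧ k ≠ j) (hne : ∃ j, j ≠ i₀)
    (G : (ι → ℂ) → (ι → ℂ))
    (horth : ∀ x y, x ≠ 0 → y ≠ 0 → star x ⬝ᵥ y = 0 → star (G x) ⬝ᵥ G y = 0)
    (hcoord : ∀ x, x ≠ 0 → ∀ i, G x i = 0 ↔ x i = 0) :
    ∃ u : ι → ℂ, (∀ i, star (u i) * u i = 1) ∧ ∃ h : ℂ →+* ℂ,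
      (h = RingHom.id ℂ ∨ h = starRingEnd ℂ) ∧
      ∀ x, x ≠ 0 → ∃ c : ℂ, G x = c • (fun i => u i * h (x i)) := by
  let E : ι → ℂ → (ι → ℂ) := fun j a => Pi.single i₀ 1 + Pi.single j a
  have hE0 : ∀ j a, j ≠ i₀ → E j a i₀ = 1 := by
    intro j a hj; simp [E, Pi.single_eq_of_ne hj.symm]
  have hEj : ∀ j a, j ≠ i₀ → E j a j = a := by
    intro j a hj; simp [E, Pi.single_eq_of_ne hj]
  have hEl : ∀ j a l, l ≠ i₀ → l ≠ j → E j a l = 0 := by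
    intro j a l hl hlj; simp [E, Pi.single_eq_of_ne hl, Pi.single_eq_of_ne hlj]
  have ne0 : ∀ {x : ι → ℂ} {i : ι}, x i ≠ 0 → x ≠ 0 := by
    rintro x i h rfl; exact h rfl
  have hEne : ∀ j a, j ≠ i₀ → E j a ≠ 0 := by
    intro j a hj
    exact ne0 (i := i₀) (by rw [hE0 j a hj]; exact one_ne_zero)
  let σ : ι → ℂ → ℂ := fun j a => G (E j a) j / G (E j a) i₀
  -- Each coordinate ratio of the image depends only on the corresponding ratio of `x`.
  have hσ : ∀ x j, x i₀ ≠ 0 → j ≠ i₀ → G x j / G x i₀ = σ j (x j / x i₀) := by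
    intro x j hx hj
    by_cases hxj : x j = 0
    · have e1 : G x j = 0 := (hcoord x (ne0 hx) j).2 hxj
      have e2 : G (E j 0) j = 0 := (hcoord _ (hEne j 0 hj) j).2 (hEj j 0 hj)
      simp [σ, hxj, e1, e2]
    -- With this `b`, `E j b` is orthogonal to every vector with the same ratio of coordinates `j`
    -- and `i₀` as `x`; orthogonality of the images then fixes their ratio.
    · let b : ℂ := star (- x i₀ / x j)
      have hb : b ≠ 0 := by
        simp only [b, ne_eq, star_eq_zero]
        exact div_ne_zero (neg_ne_zero.2 hx) hxj
      have hy := hEne j b hj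
      have hyj : G (E j b) j ≠ 0 := by rw [ne_eq, hcoord _ hy, hEj j b hj]; exact hb
      have main : ∀ z : ι → ℂ, z i₀ ≠ 0 → z j / z i₀ = x j / x i₀ →
          star (G (E j b) i₀) + star (G (E j b) j) * (G z j / G z i₀) = 0 := by
        intro z hz hzx
        have hGz : G z i₀ ≠ 0 := by rw [ne_eq, hcoord _ (ne0 hz)]; exact hz
        have := horth (E j b) z hy (ne0 hz) (by
          rw [star_dotProduct_eq_pair hj.symm (hEl j b), hE0 j b hj, hEj j b hj]
          simp only [b, star_star]
          rw [div_eq_div_iff hz hx] at hzx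
          rw [star_one]
          field_simp
          linear_combination -hzx)
        rw [star_dotProduct_eq_pair hj.symm (fun k hk hkj =>
          (hcoord _ hy k).2 (hEl j b k hk hkj))] at this
        field_simp
        linear_combination this
      have m1 := main x hx rfl
      have m2 := main (E j (x j / x i₀)) (by rw [hE0 _ _ hj]; exact one_ne_zero)
        (by rw [hE0 _ _ hj, hEj _ _ hj, div_one])
      have : star (G (E j b) j) ≠ 0 := star_ne_zero.2 hyj
      exact mul_left_cancel₀ this (by linear_combination m1 - m2)
  have hσ0 : ∀ j, j ≠ i₀ → σ j 0 = 0 := by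
    intro j hj
    have e2 : G (E j 0) j = 0 := (hcoord _ (hEne j 0 hj) j).2 (hEj j 0 hj)
    simp [σ, e2]
  -- vectors supported on three coordinates
  let T : ι → ι → ℂ → ℂ → (ι → ℂ) := fun j k a b =>
    Pi.single i₀ 1 + Pi.single j a + Pi.single k b
  have hpair : ∀ j k, j ≠ i₀ → k ≠ i₀ → k ≠ j → ∃ h : ℂ →+* ℂ,
      ((∀ z, h (star z) = star (h z)) ∧ (∀ a, σ j a = σ j 1 * h a) ∧
      star (σ j 1) * σ j 1 = 1) ∧ ∃ κ, ∀ a, σ j a = κ * σ k a := by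
    intro j k hj hk hkj
    have T0 : ∀ a b, T j k a b i₀ = 1 := by
      intro a b; simp [T, Pi.single_eq_of_ne hj.symm, Pi.single_eq_of_ne hk.symm]
    have Tj : ∀ a b, T j k a b j = a := by
      intro a b; simp [T, Pi.single_eq_of_ne hj, Pi.single_eq_of_ne hkj.symm]
    have Tk : ∀ a b, T j k a b k = b := by
      intro a b; simp [T, Pi.single_eq_of_ne hk, Pi.single_eq_of_ne hkj]
    have Tl : ∀ a b l, l ≠ i₀ → l ≠ j → l ≠ k → T j k a b l = 0 := by
      intro a b l h1 h2 h3
      simp [T, Pi.single_eq_of_ne h1, Pi.single_eq_of_ne h2, Pi.single_eq_of_ne h3]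
    have T0' : ∀ a b, T j k a b i₀ ≠ 0 := fun a b => by rw [T0]; exact one_ne_zero
    have Tne : ∀ a b, T j k a b ≠ 0 := fun a b => ne0 (T0' a b)
    have GT0 : ∀ a b, G (T j k a b) i₀ ≠ 0 := fun a b => by
      rw [ne_eq, hcoord _ (Tne a b)]; exact T0' a b
    have GTj : ∀ a b, G (T j k a b) j = G (T j k a b) i₀ * σ j a := by
      intro a b
      have := hσ (T j k a b) j (T0' a b) hj
      rw [Tj, T0, div_one] at this
      rw [← this, mul_div_cancel₀ _ (GT0 a b)]
    have GTk : ∀ a b, G (T j k a b) k = G (T j k a b) i₀ * σ k b := by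
      intro a b
      have := hσ (T j k a b) k (T0' a b) hk
      rw [Tk, T0, div_one] at this
      rw [← this, mul_div_cancel₀ _ (GT0 a b)]
    -- Orthogonality of `z` to every `T j k a a` makes `σ j` and `σ k` proportional, with a constant
    -- independent of `a`.
    let z : ι → ℂ := Pi.single j 1 + Pi.single k (-1)
    have zj : z j = 1 := by simp [z, Pi.single_eq_of_ne hkj.symm]
    have zk : z k = -1 := by simp [z, Pi.single_eq_of_ne hkj]
    have zl : ∀ l, l ≠ j → l ≠ k → z l = 0 := by
      intro l h1 h2; simp [z, Pi.single_eq_of_ne h1, Pi.single_eq_of_ne h2]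
    have zne : z ≠ 0 := ne0 (i := j) (by rw [zj]; exact one_ne_zero)
    have Gzj : star (G z j) ≠ 0 := star_ne_zero.2 (by rw [ne_eq, hcoord _ zne, zj]; exact one_ne_zero)
    have hκ : ∀ a, σ j a = (- star (G z k) / star (G z j)) * σ k a := by
      intro a
      have := horth z (T j k a a) zne (Tne a a) (by
        rw [star_dotProduct_eq_pair hkj.symm zl, zj, zk, Tj, Tk]; simp)
      rw [star_dotProduct_eq_pair hkj.symm (fun l h1 h2 => (hcoord _ zne l).2 (zl l h1 h2)),
        GTj, GTk] at this
      have h2 : G (T j k a a) i₀ * (star (G z j) * σ j a + star (G z k) * σ k a) = 0 := by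
        linear_combination this
      have h3 := (mul_eq_zero.1 h2).resolve_left (GT0 a a)
      field_simp
      linear_combination h3
    obtain ⟨h, hh⟩ := exists_ringHom_of_orthogonality_preserving (σ j) (σ k)
      (- star (G z k) / star (G z j)) (hσ0 j hj) (hσ0 k hk) hκ (by
      intro a b c d habcd
      have := horth (T j k a b) (T j k c d) (Tne a b) (Tne c d) (by
        rw [star_dotProduct_eq_triple hj.symm hk.symm hkj.symm (Tl a b), T0, T0, Tj, Tk, Tj, Tk,
          star_one, one_mul, habcd])
      rw [star_dotProduct_eq_triple hj.symm hk.symm hkj.symm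
        (fun l h1 h2 h3 => (hcoord _ (Tne a b) l).2 (Tl a b l h1 h2 h3)),
        GTj, GTk, GTj, GTk, star_mul', star_mul'] at this
      have h2 : (star (G (T j k a b) i₀) * G (T j k c d) i₀) *
          (1 + star (σ j a) * σ j c + star (σ k b) * σ k d) = 0 := by
        linear_combination this
      exact (mul_eq_zero.1 h2).resolve_left (mul_ne_zero (star_ne_zero.2 (GT0 a b)) (GT0 c d)))
    exact ⟨h, hh, _, hκ⟩
  obtain ⟨j₀, hj₀⟩ := hne
  obtain ⟨k₀, hk₀, hkj₀⟩ := hcard j₀ hj₀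
  obtain ⟨h, ⟨hs, hσh₀, -⟩, -⟩ := hpair j₀ k₀ hj₀ hk₀ hkj₀
  have hσh : ∀ j, j ≠ i₀ → ∀ a, σ j a = σ j 1 * h a := by
    intro j hj a
    by_cases hjj : j = j₀
    · rw [hjj]; exact hσh₀ a
    · obtain ⟨_, _, κ, hκ⟩ := hpair j j₀ hj hj₀ (Ne.symm hjj)
      rw [hκ a, hκ 1, hσh₀ a]; ring
  have hσu : ∀ j, j ≠ i₀ → star (σ j 1) * σ j 1 = 1 := by
    intro j hj
    obtain ⟨k, hk, hkj⟩ := hcard j hj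
    obtain ⟨_, ⟨_, _, h3⟩, _⟩ := hpair j k hj hk hkj
    exact h3
  have hcases := Complex.ringHom_eq_id_or_conj_of_commute_star h hs
  have hh : ∀ z, h (h z) = z := by
    rcases hcases with rfl | rfl <;> simp
  let u : ι → ℂ := fun i => if i = i₀ then 1 else σ i 1
  have hu : ∀ i, star (u i) * u i = 1 := by
    intro i
    by_cases hi : i = i₀
    · simp [u, hi]
    · simp only [u, if_neg hi]; exact hσu i hi
  have hgen : ∀ x : ι → ℂ, x i₀ ≠ 0 → ∃ c : ℂ, G x = c • (fun i => u i * h (x i)) := by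
    intro x hx
    have hGx : G x i₀ ≠ 0 := by rw [ne_eq, hcoord _ (ne0 hx)]; exact hx
    have hhx : h (x i₀) ≠ 0 := by rwa [ne_eq, map_eq_zero]
    refine ⟨G x i₀ / h (x i₀), ?_⟩
    ext i
    simp only [Pi.smul_apply, smul_eq_mul]
    by_cases hi : i = i₀
    · subst hi; simp only [u, if_true]; field_simp
    · have := hσ x i hx hi
      rw [hσh i hi, map_div₀] at this
      simp only [u, if_neg hi]
      field_simp at this ⊢
      linear_combination this
  refine ⟨u, hu, h, hcases, fun x hx => ?_⟩
  by_cases hx0 : x i₀ ≠ 0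
  · exact hgen x hx0
  push Not at hx0
  -- For `x i₀ = 0`, the phase-corrected image `m` should be a multiple of `y`. Its component `b`
  -- orthogonal to `y` is shifted by the `i₀` basis vector so that `hgen` applies to a preimage;
  -- this gives `b ⟂ m`, hence `b ⟂ b`.
  let y : ι → ℂ := fun i => h (x i)
  let m : ι → ℂ := fun i => star (u i) * G x i
  have hy0 : y i₀ = 0 := by simp [y, hx0]
  have hm0 : m i₀ = 0 := by simp [m, (hcoord x hx i₀).2 hx0]
  have hyne : star y ⬝ᵥ y ≠ 0 := by
    rw [ne_eq, Complex.star_dotProduct_self_eq_zero]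
    intro hy
    apply hx
    ext i
    exact (map_eq_zero h).1 (congrFun hy i)
  let c : ℂ := (star y ⬝ᵥ m) / (star y ⬝ᵥ y)
  let b : ι → ℂ := m - c • y
  have hb0 : b i₀ = 0 := by simp [b, hm0, hy0]
  have hyb : star y ⬝ᵥ b = 0 := by
    simp only [b, dotProduct_sub, dotProduct_smul, smul_eq_mul, c]
    field_simp
    ring
  have hby : star b ⬝ᵥ y = 0 := by
    rw [← star_dotProduct_comm, hyb, star_zero]
  let b' : ι → ℂ := b + Pi.single i₀ 1
  let a : ι → ℂ := fun i => h (b' i)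
  have hha : (fun i => h (a i)) = b' := by ext i; exact hh _
  have hb'0 : b' i₀ = 1 := by simp [b', hb0]
  have hb'dot : ∀ w : ι → ℂ, w i₀ = 0 → star b' ⬝ᵥ w = star b ⬝ᵥ w := by
    intro w hw
    have : star b' = star b + Pi.single i₀ 1 := by
      simp only [b', star_add]
      rw [← Pi.single_star, star_one]
    rw [this, add_dotProduct, single_dotProduct, hw, mul_zero, add_zero]
  have ha0 : a i₀ ≠ 0 := by simp [a, hb'0]
  have hax : star a ⬝ᵥ x = 0 := by
    apply (map_eq_zero h).1
    rw [← star_dotProduct_comp_ringHom h hs, hha, hb'dot _ hy0, hby]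
  have hGax := horth a x (ne0 ha0) hx hax
  obtain ⟨c', hc'⟩ := hgen a ha0
  have hc'0 : c' ≠ 0 := by
    rintro rfl
    rw [zero_smul] at hc'
    have : G a i₀ = 0 := by rw [hc']; rfl
    exact ha0 ((hcoord _ (ne0 ha0) _).1 this)
  have hGax' : star (G a) ⬝ᵥ G x = star c' * (star b' ⬝ᵥ m) := by
    rw [hc', ← hha]
    simp only [dotProduct, Finset.mul_sum, m, Pi.star_apply, Pi.smul_apply, smul_eq_mul, star_mul']
    refine Finset.sum_congr rfl fun i _ => ?_
    ring
  rw [hGax', hb'dot _ hm0] at hGax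
  have hbm := (mul_eq_zero.1 hGax).resolve_left (star_ne_zero.2 hc'0)
  have hbb : star b ⬝ᵥ b = 0 := by
    conv_lhs => rw [show b = m - c • y from rfl]
    rw [dotProduct_sub, dotProduct_smul]
    rw [show star (m - c • y) = star b from rfl, hbm, hby, smul_zero, sub_zero]
  rw [Complex.star_dotProduct_self_eq_zero] at hbb
  refine ⟨c, ?_⟩
  ext i
  have h1 : m i = c * y i := by
    have := congrFun hbb i
    simp only [b, Pi.sub_apply, Pi.smul_apply, smul_eq_mul, Pi.zero_apply] at this
    linear_combination this
  simp only [Pi.smul_apply, smul_eq_mul]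
  simp only [m, y] at h1
  linear_combination u i * h1 - G x i * hu i

/-- Uhlhorn's theorem: a map on nonzero vectors of a complex space of dimension at least three
which preserves orthogonality in both directions is, up to scalars, unitary or antiunitary. -/
theorem exists_unitary_of_preserves_orthogonality {n : ℕ} (hn : 3 ≤ n)
    (F : (Fin n → ℂ) → (Fin n → ℂ)) (hF : ∀ x, x ≠ 0 → F x ≠ 0)
    (horth : ∀ x y, x ≠ 0 → y ≠ 0 → (star x ⬝ᵥ y = 0 ↔ star (F x) ⬝ᵥ F y = 0)) :
    ∃ U ∈ Matrix.unitaryGroup (Fin n) ℂ,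
      (∀ x, x ≠ 0 → ∃ c : ℂ, F x = c • (U *ᵥ x)) ∨
      (∀ x, x ≠ 0 → ∃ c : ℂ, F x = c • (U *ᵥ star x)) := by
  let e : Fin n → (Fin n → ℂ) := fun i => Pi.single i 1
  have he : ∀ i, e i ≠ 0 := fun i => by simp [e]
  let r : Fin n → ℝ := fun i => Real.sqrt (∑ k, Complex.normSq (F (e i) k))
  have hdot : ∀ v : Fin n → ℂ, star v ⬝ᵥ v = ((∑ k, Complex.normSq (v k) : ℝ) : ℂ) := by
    intro v
    simp only [dotProduct, Pi.star_apply, Complex.star_def, Complex.ofReal_sum]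
    refine Finset.sum_congr rfl fun k _ => ?_
    rw [mul_comm, Complex.mul_conj]
  have hr : ∀ i, star (F (e i)) ⬝ᵥ F (e i) = (r i : ℂ) * r i := by
    intro i
    rw [hdot, ← Complex.ofReal_mul, Real.mul_self_sqrt]
    exact Finset.sum_nonneg fun k _ => Complex.normSq_nonneg _
  have hr0 : ∀ i, (r i : ℂ) ≠ 0 := by
    intro i h0
    have := hr i
    rw [h0, mul_zero, Complex.star_dotProduct_self_eq_zero] at this
    exact hF _ (he i) this
  -- The columns are the normalised images of the basis. Coordinate `i` of `Vᴴ *ᵥ F x` vanishes iff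
  -- `F (e i) ⟂ F x`, that is, iff `x i = 0`.
  let V : Matrix (Fin n) (Fin n) ℂ := Matrix.of fun k i => (r i : ℂ)⁻¹ * F (e i) k
  have hVdot : ∀ (w : Fin n → ℂ) i, (Vᴴ *ᵥ w) i = (r i : ℂ)⁻¹ * (star (F (e i)) ⬝ᵥ w) := by
    intro w i
    simp [V, Matrix.mulVec, dotProduct, Finset.mul_sum, mul_assoc]
  have hVV : Vᴴ * V = 1 := by
    ext i j
    have e1 : (Vᴴ * V) i j = (Vᴴ *ᵥ (fun k => V k j)) i := rfl
    have e2 : (fun k => V k j) = (r j : ℂ)⁻¹ • F (e j) := rfl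
    rw [e1, hVdot, e2, dotProduct_smul]
    by_cases hij : i = j
    · subst hij
      rw [hr, Matrix.one_apply_eq, smul_eq_mul]
      have := hr0 i
      field_simp
    · rw [(horth _ _ (he i) (he j)).1 (by simp [e, Ne.symm hij]), Matrix.one_apply_ne hij]
      simp
  have hV : V ∈ Matrix.unitaryGroup (Fin n) ℂ := Matrix.mem_unitaryGroup_iff'.2 hVV
  have hVV' : V * Vᴴ = 1 := Matrix.mem_unitaryGroup_iff.1 hV
  let i₀ : Fin n := ⟨0, by omega⟩
  obtain ⟨u, hu, h, hcases, hG⟩ := exists_diagonal_of_preserves_orthogonality i₀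
    (fun j hj => by
      by_cases h1 : j = ⟨1, by omega⟩
      · exact ⟨⟨2, by omega⟩, by simp [i₀], by rw [h1]; simp⟩
      · exact ⟨⟨1, by omega⟩, by simp [i₀], Ne.symm h1⟩)
    ⟨⟨1, by omega⟩, by simp [i₀]⟩ (fun x => Vᴴ *ᵥ F x)
    (fun x y hx hy hxy => by
      rw [Matrix.star_mulVec, Matrix.conjTranspose_conjTranspose, ← Matrix.dotProduct_mulVec,
        Matrix.mulVec_mulVec, hVV', Matrix.one_mulVec]
      exact (horth x y hx hy).1 hxy)
    (fun x hx i => by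
      rw [hVdot, mul_eq_zero, or_iff_right (inv_ne_zero (hr0 i)), ← horth _ _ (he i) hx]
      simp [e])
  have hD : Matrix.diagonal u ∈ Matrix.unitaryGroup (Fin n) ℂ := by
    rw [Matrix.mem_unitaryGroup_iff', Matrix.star_eq_conjTranspose, Matrix.diagonal_conjTranspose,
      Matrix.diagonal_mul_diagonal, ← Matrix.diagonal_one]
    exact congrArg _ (funext hu)
  refine ⟨V * Matrix.diagonal u, mul_mem hV hD, ?_⟩
  have hfin : ∀ x, x ≠ 0 → ∃ c : ℂ, F x = c • ((V * Matrix.diagonal u) *ᵥ fun i => h (x i)) := by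
    intro x hx
    obtain ⟨c, hc⟩ := hG x hx
    refine ⟨c, ?_⟩
    have e1 : (fun i => u i * h (x i)) = Matrix.diagonal u *ᵥ fun i => h (x i) := by
      ext i; rw [Matrix.mulVec_diagonal]
    rw [e1] at hc
    have := congrArg (fun v => V *ᵥ v) hc
    simp only [Matrix.mulVec_mulVec, hVV', Matrix.one_mulVec, Matrix.mulVec_smul] at this
    rw [this]
  rcases hcases with rfl | rfl
  · exact Or.inl hfin
  · exact Or.inr hfin

end Uhlhorn

/-! ### Rank-one projections and commutants. -/

namespace ProjMat

variable {n : ℕ}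

/-- Commutativity of two projections. -/
def Comm (P Q : ProjMat n) : Prop := P.1 * Q.1 = Q.1 * P.1

theorem Comm.symm {P Q : ProjMat n} (h : Comm P Q) : Comm Q P := Eq.symm h

theorem comm_comm {P Q : ProjMat n} : Comm P Q ↔ Comm Q P := ⟨Comm.symm, Comm.symm⟩

theorem comm_compl {P Q : ProjMat n} : Comm P Q.compl ↔ Comm P Q := by
  simp [Comm, compl, mul_sub, sub_mul]

theorem mulVec_self (P : ProjMat n) (v : Fin n → ℂ) : P.1 *ᵥ (P.1 *ᵥ v) = P.1 *ᵥ v := by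
  rw [Matrix.mulVec_mulVec, P.2.1]

theorem ext_mulVec {A B : Matrix (Fin n) (Fin n) ℂ} (h : ∀ v, A *ᵥ v = B *ᵥ v) : A = B :=
  Matrix.mulVec_injective (funext h)

/-- The orthogonal projection onto the span of `x`. -/
noncomputable def ofVec (x : Fin n → ℂ) : ProjMat n :=
  ⟨(star x ⬝ᵥ x)⁻¹ • Matrix.vecMulVec x (star x), by
    by_cases hx : x = 0
    · simp [hx]
    have hx' : star x ⬝ᵥ x ≠ 0 := fun h => hx (Complex.star_dotProduct_self_eq_zero.1 h)
    constructor
    · rw [Matrix.smul_mul, Matrix.mul_smul, Matrix.vecMulVec_mul_vecMulVec, Matrix.vecMulVec_smul]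
      simp only [smul_smul]
      congr 1
      field_simp
    · rw [Matrix.conjTranspose_smul, Matrix.conjTranspose_vecMulVec, star_star, star_inv₀,
        star_dotProduct_comm]⟩

theorem ofVec_mulVec (x y : Fin n → ℂ) :
    (ofVec x).1 *ᵥ y = ((star x ⬝ᵥ x)⁻¹ * (star x ⬝ᵥ y)) • x := by
  simp only [ofVec, Matrix.smul_mulVec, Matrix.vecMulVec_mulVec]
  ext i
  simp
  ring

theorem ofVec_mulVec_self (x : Fin n → ℂ) : (ofVec x).1 *ᵥ x = x := by
  by_cases hx : x = 0
  · simp [hx]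
  have hx' : star x ⬝ᵥ x ≠ 0 := fun h => hx (Complex.star_dotProduct_self_eq_zero.1 h)
  rw [ofVec_mulVec, inv_mul_cancel₀ hx', one_smul]

theorem mul_ofVec (Q : Matrix (Fin n) (Fin n) ℂ) (x : Fin n → ℂ) :
    Q * (ofVec x).1 = (star x ⬝ᵥ x)⁻¹ • Matrix.vecMulVec (Q *ᵥ x) (star x) := by
  simp only [ofVec, Matrix.mul_smul, Matrix.mul_vecMulVec]

theorem mul_ofVec_of_mulVec_eq_self {Q : Matrix (Fin n) (Fin n) ℂ} {x : Fin n → ℂ}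
    (h : Q *ᵥ x = x) : Q * (ofVec x).1 = (ofVec x).1 := by
  rw [mul_ofVec, h]; rfl

theorem mul_ofVec_of_mulVec_eq_zero {Q : Matrix (Fin n) (Fin n) ℂ} {x : Fin n → ℂ}
    (h : Q *ᵥ x = 0) : Q * (ofVec x).1 = 0 := by
  rw [mul_ofVec, h]; simp

theorem mul_comm_of_mul_eq {P Q R : ProjMat n} (h : P.1 * Q.1 = R.1) : Q.1 * P.1 = R.1 := by
  have := congrArg Matrix.conjTranspose h
  rwa [Matrix.conjTranspose_mul, P.2.2, Q.2.2, R.2.2] at this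

theorem mul_eq_zero_comm {P Q : ProjMat n} (h : P.1 * Q.1 = 0) : Q.1 * P.1 = 0 := by
  have := congrArg Matrix.conjTranspose h
  rwa [Matrix.conjTranspose_mul, P.2.2, Q.2.2, Matrix.conjTranspose_zero] at this

theorem comm_ofVec_iff {x : Fin n → ℂ} (hx : x ≠ 0) (Q : ProjMat n) :
    Comm (ofVec x) Q ↔ Q.1 *ᵥ x = x ∨ Q.1 *ᵥ x = 0 := by
  constructor
  · intro h
    have h1 : Q.1 *ᵥ x = (ofVec x).1 *ᵥ (Q.1 *ᵥ x) := by
      conv_lhs => rw [← ofVec_mulVec_self x]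
      rw [Matrix.mulVec_mulVec, Matrix.mulVec_mulVec, h.symm]
    rw [ofVec_mulVec] at h1
    generalize (star x ⬝ᵥ x)⁻¹ * (star x ⬝ᵥ Q.1 *ᵥ x) = c at h1
    have h2 := mulVec_self Q x
    rw [h1, Matrix.mulVec_smul, h1, smul_smul] at h2
    have h3 : c * c = c := smul_left_injective ℂ hx h2
    rcases eq_or_ne c 0 with hc | hc
    · right; rw [h1, hc, zero_smul]
    · left; rw [h1, mul_left_cancel₀ hc (h3.trans (mul_one c).symm), one_smul]
  · rintro (h | h)
    · have h1 := mul_ofVec_of_mulVec_eq_self h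
      exact (mul_comm_of_mul_eq h1).trans h1.symm
    · have h1 := mul_ofVec_of_mulVec_eq_zero h
      exact (mul_eq_zero_comm h1).trans h1.symm

theorem trace_ofVec {x : Fin n → ℂ} (hx : x ≠ 0) : (ofVec x).1.trace = 1 := by
  have hx' : star x ⬝ᵥ x ≠ 0 := fun h => hx (Complex.star_dotProduct_self_eq_zero.1 h)
  simp only [ofVec, Matrix.trace_smul, Matrix.trace_vecMulVec, smul_eq_mul]
  rw [dotProduct_comm x, inv_mul_cancel₀ hx']

theorem exists_mulVec_eq_self {P : ProjMat n} (hP : P.1 ≠ 0) : ∃ v, v ≠ 0 ∧ P.1 *ᵥ v = v := by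
  by_contra! h
  apply hP
  refine ext_mulVec fun v => ?_
  rw [Matrix.zero_mulVec]
  by_contra hv
  exact h _ hv (mulVec_self P v)

/-- Every nonzero vector in the range of `N` is an eigenvector of `X`. Both eigenvalues cannot occur
there, since a sum of eigenvectors for 1 and 0 is not an eigenvector. -/
theorem mul_eq_self_or_zero {X N : ProjMat n}
    (h : ∀ y, y ≠ 0 → N.1 *ᵥ y = y → Comm (ofVec y) X) :
    X.1 * N.1 = N.1 ∨ X.1 * N.1 = 0 := by
  by_contra! hcon
  obtain ⟨h1, h2⟩ := hcon
  have key : ∀ v, X.1 *ᵥ (N.1 *ᵥ v) = N.1 *ᵥ v ∨ X.1 *ᵥ (N.1 *ᵥ v) = 0 := by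
    intro v
    by_cases hv : N.1 *ᵥ v = 0
    · simp [hv]
    · exact (comm_ofVec_iff hv X).1 (h _ hv (mulVec_self N v))
  have e1 : ∃ v, X.1 *ᵥ (N.1 *ᵥ v) ≠ N.1 *ᵥ v := by
    by_contra! h'
    exact h1 (ext_mulVec fun v => by rw [← Matrix.mulVec_mulVec, h'])
  have e2 : ∃ v, X.1 *ᵥ (N.1 *ᵥ v) ≠ 0 := by
    by_contra! h'
    exact h2 (ext_mulVec fun v => by rw [← Matrix.mulVec_mulVec, h', Matrix.zero_mulVec])
  obtain ⟨v, hv⟩ := e1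
  obtain ⟨w, hw⟩ := e2
  have hv' := (key v).resolve_left hv
  have hw' := (key w).resolve_right hw
  have := key (v + w)
  rw [Matrix.mulVec_add, Matrix.mulVec_add, hv', hw', zero_add] at this
  rcases this with h3 | h3
  · rw [hv'] at hv
    exact hv (right_eq_add.1 h3).symm
  · rw [hw', h3] at hw
    exact hw rfl

theorem mul_compl_self (P : ProjMat n) : P.1 * P.compl.1 = 0 := by
  simp [compl, mul_sub, P.2.1]

theorem compl_mulVec (P : ProjMat n) (v : Fin n → ℂ) : P.compl.1 *ᵥ v = v - P.1 *ᵥ v := by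
  simp [compl, Matrix.sub_mulVec]

theorem eq_of_comm_ofVec {P Q : ProjMat n}
    (h : ∀ x, x ≠ 0 → Comm (ofVec x) P → Comm (ofVec x) Q) :
    Q.1 = 0 ∨ Q.1 = 1 ∨ Q.1 = P.1 ∨ Q.1 = P.compl.1 := by
  have h1 : Q.1 * P.1 = P.1 ∨ Q.1 * P.1 = 0 := mul_eq_self_or_zero fun y hy hPy =>
    h y hy ((comm_ofVec_iff hy P).2 (Or.inl hPy))
  have h2 : Q.1 * P.compl.1 = P.compl.1 ∨ Q.1 * P.compl.1 = 0 :=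
    mul_eq_self_or_zero fun y hy hPy =>
      h y hy (comm_compl.1 ((comm_ofVec_iff hy P.compl).2 (Or.inl hPy)))
  have h3 : Q.1 = Q.1 * P.1 + Q.1 * P.compl.1 := by simp [compl, mul_sub]
  rcases h1 with h1 | h1 <;> rcases h2 with h2 | h2 <;> rw [h1, h2] at h3
  · right; left; rw [h3]; simp [compl]
  · right; right; left; rw [h3, add_zero]
  · right; right; right; rw [h3, zero_add]
  · left; rw [h3, add_zero]

/-! ### Detecting rank or corank one by commutativity. -/

/-- `X` lies in the bicommutant of `{P, R}` relative to the set of projections. -/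
def MemBicommutant (P R X : ProjMat n) : Prop := ∀ T, Comm T P → Comm T R → Comm T X

/-- Some projection commuting with `P` generates with it an abelian algebra with four atoms. -/
def IsThick (P : ProjMat n) : Prop :=
  ∃ R, Comm R P ∧ ∃ X, MemBicommutant P R X ∧ ¬ MemBicommutant P P X ∧ ¬ MemBicommutant P X R

/-- `P` commutes with every projection. -/
def IsCentral (P : ProjMat n) : Prop := ∀ T, Comm T P

theorem comm_of_eq_mul {T X A B : ProjMat n} (hA : Comm T A) (hB : Comm T B)
    (h : X.1 = A.1 * B.1) : Comm T X := by
  unfold Comm at *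
  rw [h, ← mul_assoc, hA, mul_assoc, hB, mul_assoc]

theorem MemBicommutant.mul_eq_self_or_zero {P R X N : ProjMat n} (hX : MemBicommutant P R X)
    (hP : P.1 * N.1 = N.1 ∨ P.1 * N.1 = 0) (hR : R.1 * N.1 = N.1 ∨ R.1 * N.1 = 0) :
    X.1 * N.1 = N.1 ∨ X.1 * N.1 = 0 := by
  have aux : ∀ {A : ProjMat n}, (A.1 * N.1 = N.1 ∨ A.1 * N.1 = 0) → ∀ y, y ≠ 0 →
      N.1 *ᵥ y = y → Comm (ofVec y) A := by
    intro A hA y hy hNy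
    rw [comm_ofVec_iff hy, ← hNy, Matrix.mulVec_mulVec]
    rcases hA with hA | hA
    · left; rw [hA]
    · right; rw [hA, Matrix.zero_mulVec]
  exact ProjMat.mul_eq_self_or_zero fun y hy hNy => hX _ (aux hP y hy hNy) (aux hR y hy hNy)

/-- A line cannot be split, so after possibly complementing `R` the only possible atoms are `P`, `R`
and `N = 1 - P - R`. If `X` is not generated by `P`, it separates `R` from `N`, and then `P` and `X`
recover `R`. -/
theorem not_isThick_ofVec {x : Fin n → ℂ} (hx : x ≠ 0) : ¬ IsThick (ofVec x) := by
  set P := ofVec x with hPdef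
  have main : ∀ R X : ProjMat n, R.1 * P.1 = 0 → MemBicommutant P R X →
      ¬ MemBicommutant P P X → MemBicommutant P X R := by
    intro R X hRP hX hXP
    have hPR : P.1 * R.1 = 0 := mul_eq_zero_comm hRP
    let N : ProjMat n := ⟨1 - P.1 - R.1, by
      constructor
      · simp only [mul_sub, sub_mul, P.2.1, R.2.1, hPR, hRP]; simp
      · simp [P.2.2, R.2.2]⟩
    have hN : N.1 = 1 - P.1 - R.1 := rfl
    have hPX : X.1 * P.1 = P.1 ∨ X.1 * P.1 = 0 :=
      hX.mul_eq_self_or_zero (Or.inl P.2.1) (Or.inr hRP)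
    have hRX : X.1 * R.1 = R.1 ∨ X.1 * R.1 = 0 :=
      hX.mul_eq_self_or_zero (Or.inr hPR) (Or.inl R.2.1)
    have hNX : X.1 * N.1 = N.1 ∨ X.1 * N.1 = 0 :=
      hX.mul_eq_self_or_zero (Or.inr (by simp [hN, mul_sub, P.2.1, hPR]))
        (Or.inr (by simp [hN, mul_sub, R.2.1, hRP]))
    have hXsum : X.1 = X.1 * P.1 + X.1 * R.1 + X.1 * N.1 := by
      rw [hN]; simp [mul_sub]
    have hcompl : X.1 * P.compl.1 = X.1 * R.1 + X.1 * N.1 := by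
      rw [hN]; simp [compl, mul_sub]
    have hP1 : P.compl.1 = R.1 + N.1 := by rw [hN]; simp [compl]
    have same : (X.1 * P.compl.1 = P.compl.1 ∨ X.1 * P.compl.1 = 0) → MemBicommutant P P X := by
      intro h T hT _
      have hsum : X.1 = X.1 * P.1 + X.1 * P.compl.1 := by simp [compl, mul_sub]
      have hT' : Comm T P.compl := comm_compl.2 hT
      unfold Comm at hT hT' ⊢
      rcases hPX with h1 | h1 <;> rcases h with h2 | h2 <;> rw [hsum, h1, h2] <;>
        simp [mul_add, add_mul, hT, hT']
    rcases hRX with h1 | h1 <;> rcases hNX with h2 | h2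
    · exact absurd (same (Or.inl (by rw [hcompl, hP1, h1, h2]))) hXP
    · intro T hT hTX
      refine comm_of_eq_mul hTX (comm_compl.2 hT) ?_
      rw [hcompl, h1, h2, add_zero]
    · intro T hT hTX
      have hTN : Comm T N := by
        refine comm_of_eq_mul hTX (comm_compl.2 hT) ?_
        rw [hcompl, h1, h2, zero_add]
      have hR : R.1 = 1 - P.1 - N.1 := by rw [hN]; abel
      unfold Comm at *
      rw [hR]
      simp [mul_sub, sub_mul, hT, hTN]
    · exact absurd (same (Or.inr (by rw [hcompl, h1, h2, add_zero]))) hXP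
  rintro ⟨R, hRP, X, h1, h2, h3⟩
  rcases (comm_ofVec_iff hx R).1 hRP.symm with h | h
  · have hR : R.compl.1 * P.1 = 0 := mul_ofVec_of_mulVec_eq_zero (by rw [compl_mulVec, h, sub_self])
    have := main R.compl X hR (fun T hT hTR => h1 T hT (comm_compl.1 hTR)) h2
    exact h3 fun T hT hTX => comm_compl.1 (this T hT hTX)
  · exact h3 (main R X (mul_ofVec_of_mulVec_eq_zero h) h1 h2)

theorem exists_orthogonal_pair {P : ProjMat n} (hP : P.1 ≠ 0)
    (h : ∀ x, x ≠ 0 → P ≠ ofVec x) :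
    ∃ u v, u ≠ 0 ∧ v ≠ 0 ∧ P.1 *ᵥ u = u ∧ P.1 *ᵥ v = v ∧ (ofVec u).1 *ᵥ v = 0 := by
  obtain ⟨u, hu, hPu⟩ := exists_mulVec_eq_self hP
  have h1 := mul_ofVec_of_mulVec_eq_self hPu
  have h2 := mul_comm_of_mul_eq h1
  let b : ProjMat n := ⟨P.1 - (ofVec u).1, by
    constructor
    · simp [mul_sub, sub_mul, h1, h2, P.2.1, (ofVec u).2.1]
    · rw [Matrix.conjTranspose_sub, P.2.2, (ofVec u).2.2]⟩
  have hb : b.1 ≠ 0 := fun hb => h u hu (Subtype.ext (sub_eq_zero.1 hb))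
  obtain ⟨v, hv, hbv⟩ := exists_mulVec_eq_self hb
  refine ⟨u, v, hu, hv, hPu, ?_, ?_⟩
  · rw [← hbv, Matrix.mulVec_mulVec]
    simp only [b, mul_sub, h1, P.2.1]
  · rw [← hbv, Matrix.mulVec_mulVec]
    simp only [b, mul_sub, h2, (ofVec u).2.1, sub_self, Matrix.zero_mulVec]

/-- Otherwise the range and kernel of `P` contain orthogonal pairs `u, v` and `w, z`. The witnesses
are `R`, projecting onto the span of `u, w`, and `X = P R`, projecting onto `u`. The line of `u + v`
shows that `P` does not generate `X`; that of `w + z` shows that `P, X` do not generate `R`. -/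
theorem exists_ofVec_of_not_isThick {P : ProjMat n} (hc : ¬ IsCentral P) (ht : ¬ IsThick P) :
    ∃ x, x ≠ 0 ∧ (P = ofVec x ∨ P.compl = ofVec x) := by
  by_contra! hcon
  have hP0 : P.1 ≠ 0 := by
    intro h; apply hc; intro T; simp [Comm, h]
  have hP1 : P.compl.1 ≠ 0 := by
    intro h; apply hc; intro T; rw [← comm_compl]; simp [Comm, h]
  obtain ⟨u, v, hu, hv, hPu, hPv, huv⟩ := exists_orthogonal_pair hP0 fun x hx => (hcon x hx).1
  obtain ⟨w, z, hw, hz, hPw, hPz, hwz⟩ := exists_orthogonal_pair hP1 fun x hx => (hcon x hx).2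
  have hPw' : P.1 *ᵥ w = 0 := by rw [compl_mulVec] at hPw; exact sub_eq_self.1 hPw
  have hPz' : P.1 *ᵥ z = 0 := by rw [compl_mulVec] at hPz; exact sub_eq_self.1 hPz
  have hp1 := mul_ofVec_of_mulVec_eq_self hPu
  have hp2 := mul_comm_of_mul_eq hp1
  have hq1 := mul_ofVec_of_mulVec_eq_zero hPw'
  have hq2 := mul_eq_zero_comm hq1
  have hpq : (ofVec u).1 * (ofVec w).1 = 0 := by rw [← hp2, mul_assoc, hq1, mul_zero]
  have hqp := mul_eq_zero_comm hpq
  have hpz : ∀ y, P.1 *ᵥ y = 0 → (ofVec u).1 *ᵥ y = 0 := by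
    intro y hy; rw [← hp2, ← Matrix.mulVec_mulVec, hy, Matrix.mulVec_zero]
  let R : ProjMat n := ⟨(ofVec u).1 + (ofVec w).1, by
    constructor
    · simp [mul_add, add_mul, hpq, hqp, (ofVec u).2.1, (ofVec w).2.1]
    · rw [Matrix.conjTranspose_add, (ofVec u).2.2, (ofVec w).2.2]⟩
  have hR : R.1 = (ofVec u).1 + (ofVec w).1 := rfl
  have sum_ne : ∀ {a b : Fin n → ℂ} (p : ProjMat n), b ≠ 0 → p.1 *ᵥ a = a → p.1 *ᵥ b = 0 →
      a + b = 0 → False := by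
    intro a b p hb h1 h2 h0
    have := congrArg (fun y => p.1 *ᵥ y) h0
    simp only [Matrix.mulVec_add, h1, h2, add_zero, Matrix.mulVec_zero] at this
    rw [this, zero_add] at h0
    exact hb h0
  have not_comm : ∀ {a b : Fin n → ℂ} (p : ProjMat n), a ≠ 0 → b ≠ 0 → p.1 *ᵥ a = a →
      p.1 *ᵥ b = 0 → ¬ Comm (ofVec (a + b)) p := by
    intro a b p ha hb h1 h2 h
    rw [comm_ofVec_iff (fun h0 => sum_ne p hb h1 h2 h0), Matrix.mulVec_add, h1, h2, add_zero] at h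
    rcases h with h | h
    · exact hb (left_eq_add.1 h)
    · exact ha h
  refine ht ⟨R, ?_, ofVec u, ?_, ?_, ?_⟩
  · simp only [Comm, hR, mul_add, add_mul, hp1, hp2, hq1, hq2]
  · intro T hTP hTR
    refine comm_of_eq_mul hTP hTR ?_
    rw [hR, mul_add, hp1, hq1, add_zero]
  · intro h
    have hT : Comm (ofVec (u + v)) P :=
      (comm_ofVec_iff (fun h0 => sum_ne (ofVec u) hv (ofVec_mulVec_self u) huv h0) P).2
        (Or.inl (by rw [Matrix.mulVec_add, hPu, hPv]))
    exact not_comm (ofVec u) hu hv (ofVec_mulVec_self u) huv (h _ hT hT)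
  · intro h
    have h0 : w + z ≠ 0 := fun h0 => sum_ne (ofVec w) hz (ofVec_mulVec_self w) hwz h0
    have hP' : P.1 *ᵥ (w + z) = 0 := by rw [Matrix.mulVec_add, hPw', hPz', add_zero]
    refine not_comm R hw hz ?_ ?_
      (h _ ((comm_ofVec_iff h0 P).2 (Or.inr hP')) ((comm_ofVec_iff h0 _).2 (Or.inr (hpz _ hP'))))
    · rw [hR, Matrix.add_mulVec, hpz w hPw', ofVec_mulVec_self, zero_add]
    · rw [hR, Matrix.add_mulVec, hpz z hPz', hwz, zero_add]

theorem trace_compl (P : ProjMat n) : P.compl.1.trace = n - P.1.trace := by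
  simp [compl, Matrix.trace_sub, Matrix.trace_one]

theorem not_isCentral_ofVec (hn : 2 ≤ n) {x : Fin n → ℂ} (hx : x ≠ 0) :
    ¬ IsCentral (ofVec x) := by
  intro h
  have key := eq_of_comm_ofVec (P := ofVec (0 : Fin n → ℂ)) (Q := ofVec x) fun y _ _ => h _
  have h0 : (ofVec (0 : Fin n → ℂ)).1 = 0 := by simp [ofVec]
  have e : (ofVec x).1 = 0 ∨ (ofVec x).1 = 1 := by
    rcases key with k | k | k | k
    · exact Or.inl k
    · exact Or.inr k
    · exact Or.inl (k.trans h0)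
    · right; rw [k]; simp [compl, h0]
  have ht := trace_ofVec hx
  rcases e with e | e <;> rw [e] at ht
  · simp at ht
  · rw [Matrix.trace_one, Fintype.card_fin] at ht
    norm_cast at ht
    omega

theorem comm_ofVec_smul_iff {x : Fin n → ℂ} {c : ℂ} (hx : x ≠ 0) (hc : c ≠ 0) (T : ProjMat n) :
    Comm (ofVec (c • x)) T ↔ Comm (ofVec x) T := by
  rw [comm_ofVec_iff hx, comm_ofVec_iff (smul_ne_zero hc hx), Matrix.mulVec_smul,
    smul_right_inj hc, smul_eq_zero_iff_right hc]

/-- In dimension at least three, orthogonality of lines is expressed through commutativity. -/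
theorem orthogonal_iff_comm (hn : 3 ≤ n) {x y : Fin n → ℂ} (hx : x ≠ 0) (hy : y ≠ 0) :
    star x ⬝ᵥ y = 0 ↔ Comm (ofVec x) (ofVec y) ∧
      ¬ ∀ T, Comm (ofVec x) T ↔ Comm (ofVec y) T := by
  have hx' : star x ⬝ᵥ x ≠ 0 := fun h => hx (Complex.star_dotProduct_self_eq_zero.1 h)
  constructor
  · intro h
    have hxy : (ofVec x).1 *ᵥ y = 0 := by rw [ofVec_mulVec, h, mul_zero, zero_smul]
    refine ⟨((comm_ofVec_iff hy _).2 (Or.inr hxy)).symm, fun hT => ?_⟩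
    -- Traces exclude all options but `ofVec x`, which kills `y`. The complement has trace `n - 1`,
    -- so `n = 2` would fail here.
    have key := eq_of_comm_ofVec (P := ofVec x) (Q := ofVec y) fun z _ hz =>
      ((hT _).1 hz.symm).symm
    have ty := trace_ofVec hy
    rcases key with k | k | k | k
    · rw [k] at ty; simp at ty
    · rw [k, Matrix.trace_one, Fintype.card_fin] at ty
      norm_cast at ty
      omega
    · have := ofVec_mulVec_self y
      rw [k, hxy] at this
      exact hy this.symm
    · rw [k, trace_compl, trace_ofVec hx, sub_eq_iff_eq_add] at ty
      norm_cast at ty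
      omega
  · rintro ⟨h1, h2⟩
    rcases (comm_ofVec_iff hy _).1 h1.symm with h | h
    · exfalso
      apply h2
      intro T
      rw [ofVec_mulVec] at h
      generalize (star x ⬝ᵥ x)⁻¹ * (star x ⬝ᵥ y) = c at h
      subst h
      refine (comm_ofVec_smul_iff hx ?_ T).symm
      rintro rfl
      simp at hy
    · rw [ofVec_mulVec, smul_eq_zero, mul_eq_zero] at h
      simpa [hx, inv_eq_zero, hx'] using h

theorem ne_compl (hn : 0 < n) (P : ProjMat n) : P ≠ P.compl := by
  intro h
  have h1 := mul_compl_self P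
  rw [← h, P.2.1] at h1
  have h2 : P.1 = 1 - P.1 := congrArg Subtype.val h
  rw [h1, sub_zero] at h2
  have := congrFun (congrFun h2 ⟨0, hn⟩) ⟨0, hn⟩
  simp at this

/-! ### Transport along a commutativity-preserving map. -/

section CommutativityPreserving

variable {φ : ProjMat n → ProjMat n}

theorem memBicommutant_map_iff (hφ : Function.Surjective φ)
    (hcomm : ∀ P Q, Comm P Q ↔ Comm (φ P) (φ Q)) (P R X : ProjMat n) :
    MemBicommutant (φ P) (φ R) (φ X) ↔ MemBicommutant P R X := by
  unfold MemBicommutant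
  rw [hφ.forall]
  simp only [← hcomm]

theorem isThick_map_iff (hφ : Function.Surjective φ)
    (hcomm : ∀ P Q, Comm P Q ↔ Comm (φ P) (φ Q)) (P : ProjMat n) :
    IsThick (φ P) ↔ IsThick P := by
  unfold IsThick
  rw [hφ.exists]
  refine exists_congr fun R => ?_
  rw [← hcomm, hφ.exists]
  simp only [memBicommutant_map_iff hφ hcomm]

theorem isCentral_map_iff (hφ : Function.Surjective φ)
    (hcomm : ∀ P Q, Comm P Q ↔ Comm (φ P) (φ Q)) (P : ProjMat n) :
    IsCentral (φ P) ↔ IsCentral P := by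
  unfold IsCentral
  rw [hφ.forall]
  simp only [← hcomm]

theorem exists_lineMap (hn : 3 ≤ n) (hφ : Function.Surjective φ)
    (hcomm : ∀ P Q, Comm P Q ↔ Comm (φ P) (φ Q)) :
    ∃ F : (Fin n → ℂ) → (Fin n → ℂ), (∀ x, x ≠ 0 → F x ≠ 0) ∧
      (∀ x, x ≠ 0 → ∀ T, Comm (φ (ofVec x)) T ↔ Comm (ofVec (F x)) T) ∧
      ∀ x y, x ≠ 0 → y ≠ 0 → (star x ⬝ᵥ y = 0 ↔ star (F x) ⬝ᵥ F y = 0) := by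
  have hex : ∀ x : Fin n → ℂ, ∃ y, x ≠ 0 → y ≠ 0 ∧
      ∀ T, Comm (φ (ofVec x)) T ↔ Comm (ofVec y) T := by
    intro x
    by_cases hx : x = 0
    · exact ⟨0, fun h => absurd hx h⟩
    obtain ⟨y, hy, h⟩ := exists_ofVec_of_not_isThick (P := φ (ofVec x))
      (by rw [isCentral_map_iff hφ hcomm]; exact not_isCentral_ofVec (by omega) hx)
      (by rw [isThick_map_iff hφ hcomm]; exact not_isThick_ofVec hx)
    refine ⟨y, fun _ => ⟨hy, fun T => ?_⟩⟩
    rcases h with h | h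
    · rw [h]
    · rw [← h, comm_comm, ← comm_compl, comm_comm]
  choose F hF using hex
  refine ⟨F, fun x hx => (hF x hx).1, fun x hx => (hF x hx).2, fun x y hx hy => ?_⟩
  obtain ⟨hFx, hx'⟩ := hF x hx
  obtain ⟨hFy, hy'⟩ := hF y hy
  rw [orthogonal_iff_comm hn hx hy, orthogonal_iff_comm hn hFx hFy, ← hx', comm_comm (P := φ _),
    ← hy', ← hcomm, comm_comm (P := ofVec y)]
  simp only [← hx', ← hy']
  rw [hφ.forall (p := fun T => Comm (φ (ofVec x)) T ↔ Comm (φ (ofVec y)) T)]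
  simp only [← hcomm]

/-- If the line map induced by `φ` is implemented by `W`, and `g` is conjugation by `W`, then `φ`
agrees with `g` up to orthocomplements. -/
theorem image_pair_eq (hn : 3 ≤ n) (hφ : Function.Bijective φ)
    (hcomm : ∀ P Q, Comm P Q ↔ Comm (φ P) (φ Q)) {F W : (Fin n → ℂ) → (Fin n → ℂ)}
    (hF0 : ∀ x, x ≠ 0 → F x ≠ 0)
    (hF : ∀ x, x ≠ 0 → ∀ T, Comm (φ (ofVec x)) T ↔ Comm (ofVec (F x)) T)
    (hFW : ∀ x, x ≠ 0 → ∃ c : ℂ, F x = c • W x)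
    (hW : Function.Bijective W) (hW0 : W 0 = 0) {g : ProjMat n → ProjMat n}
    (hg : ∀ P x, (g P).1 *ᵥ W x = W (P.1 *ᵥ x))
    (hgc : ∀ P, g P.compl = (g P).compl) (P : ProjMat n) :
    φ '' {P, P.compl} = {g P, (g P).compl} := by
  have hWne : ∀ x, x ≠ 0 → W x ≠ 0 := fun x hx h => hx (hW.1 (h.trans hW0.symm))
  have key : ∀ (P : ProjMat n) x, x ≠ 0 → (Comm (ofVec x) (g P) ↔ Comm (ofVec x) (φ P)) := by
    intro P w hw
    obtain ⟨x, rfl⟩ := hW.2 w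
    have hx : x ≠ 0 := by rintro rfl; exact hw hW0
    obtain ⟨c, hc⟩ := hFW x hx
    have hc0 : c ≠ 0 := by
      rintro rfl
      exact hF0 x hx (by rw [hc, zero_smul])
    rw [← comm_ofVec_smul_iff hw hc0 (φ P), ← hc, ← hF x hx, ← hcomm, comm_ofVec_iff hw,
      comm_ofVec_iff hx, hg, hW.1.eq_iff,
      show W (P.1 *ᵥ x) = 0 ↔ P.1 *ᵥ x = 0 by rw [← hW0, hW.1.eq_iff, hW0]]
  have main : ∀ P, φ P = g P ∨ φ P = (g P).compl := by
    intro P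
    have h0 : ∀ A B : ProjMat n, A.1 = 0 →
        (B.1 = 0 ∨ B.1 = 1 ∨ B.1 = A.1 ∨ B.1 = A.compl.1) → A = B ∨ A = B.compl := by
      intro A B hA hB
      simp only [Subtype.ext_iff, compl] at hB ⊢
      rw [hA] at hB ⊢
      rcases hB with h | h | h | h <;> simp [h]
    have h1 : ∀ A B : ProjMat n, A.1 = 1 →
        (B.1 = 0 ∨ B.1 = 1 ∨ B.1 = A.1 ∨ B.1 = A.compl.1) → A = B ∨ A = B.compl := by
      intro A B hA hB
      simp only [Subtype.ext_iff, compl] at hB ⊢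
      rw [hA] at hB ⊢
      rcases hB with h | h | h | h <;> simp [h]
    -- Both directions are needed: if `φ P` is 0 or 1, `k2` forces `g P` to be trivial too.
    have k1 := eq_of_comm_ofVec fun x hx => (key P x hx).1
    have k2 := eq_of_comm_ofVec fun x hx => (key P x hx).2
    rcases k1 with k | k | k | k
    · exact h0 _ _ k k2
    · exact h1 _ _ k k2
    · exact Or.inl (Subtype.ext k)
    · exact Or.inr (Subtype.ext k)
  have hcc : (g P).compl.compl = g P := Subtype.ext (by simp [compl])
  have hne : φ P ≠ φ P.compl := fun h => ne_compl (by omega) P (hφ.1 h)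
  have hc := main P.compl
  rw [hgc, hcc] at hc
  rw [Set.image_pair]
  rcases main P with h | h <;> rcases hc with h' | h'
  · rw [h, h']
  · exact absurd (h.trans h'.symm) hne
  · exact absurd (h.trans h'.symm) hne
  · rw [h, h', Set.pair_comm]

end CommutativityPreserving

end ProjMat

/-! ### Unitary conjugation and transposition. -/

namespace ProjMat

variable {n : ℕ}

/-- Conjugation of a projection by a unitary matrix. -/
def conjUnitary {U : Matrix (Fin n) (Fin n) ℂ} (hU : U ∈ Matrix.unitaryGroup (Fin n) ℂ)
    (P : ProjMat n) : ProjMat n :=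
  ⟨U * P.1 * Uᴴ, by
    have hUU : Uᴴ * U = 1 := Matrix.mem_unitaryGroup_iff'.1 hU
    constructor
    · calc U * P.1 * Uᴴ * (U * P.1 * Uᴴ) = U * P.1 * (Uᴴ * U) * P.1 * Uᴴ := by
            simp only [mul_assoc]
        _ = U * (P.1 * P.1) * Uᴴ := by rw [hUU, mul_one]; simp only [mul_assoc]
        _ = U * P.1 * Uᴴ := by rw [P.2.1]
    · simp [Matrix.conjTranspose_mul, P.2.2, mul_assoc]⟩

theorem conjUnitary_mulVec {U : Matrix (Fin n) (Fin n) ℂ}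
    (hU : U ∈ Matrix.unitaryGroup (Fin n) ℂ) (P : ProjMat n) (x : Fin n → ℂ) :
    (conjUnitary hU P).1 *ᵥ (U *ᵥ x) = U *ᵥ (P.1 *ᵥ x) := by
  have hUU : Uᴴ * U = 1 := Matrix.mem_unitaryGroup_iff'.1 hU
  simp only [conjUnitary, Matrix.mulVec_mulVec, mul_assoc, hUU, mul_one]

theorem conjUnitary_compl {U : Matrix (Fin n) (Fin n) ℂ}
    (hU : U ∈ Matrix.unitaryGroup (Fin n) ℂ) (P : ProjMat n) :
    conjUnitary hU P.compl = (conjUnitary hU P).compl := by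
  have hUU : U * Uᴴ = 1 := Matrix.mem_unitaryGroup_iff.1 hU
  exact Subtype.ext (by simp [conjUnitary, compl, mul_sub, sub_mul, hUU])

/-- The transpose of a projection. -/
def transpose (P : ProjMat n) : ProjMat n :=
  ⟨P.1ᵀ, by rw [← Matrix.transpose_mul, P.2.1],
    by
      have h : P.1ᵀᴴ = P.1ᴴᵀ := rfl
      rw [h, P.2.2]⟩

theorem transpose_mulVec_star (P : ProjMat n) (x : Fin n → ℂ) :
    P.transpose.1 *ᵥ star x = star (P.1 *ᵥ x) := by
  rw [Matrix.star_mulVec, P.2.2, ← Matrix.mulVec_transpose]; rfl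

theorem transpose_compl (P : ProjMat n) : P.compl.transpose = P.transpose.compl :=
  Subtype.ext (by simp [transpose, compl])

end ProjMat

theorem Matrix.mulVec_bijective_of_mem_unitaryGroup {n : ℕ} {U : Matrix (Fin n) (Fin n) ℂ}
    (hU : U ∈ Matrix.unitaryGroup (Fin n) ℂ) : Function.Bijective fun x => U *ᵥ x := by
  refine Function.bijective_iff_has_inverse.2 ⟨fun x => Uᴴ *ᵥ x, fun x => ?_, fun x => ?_⟩
  · have hUU : Uᴴ * U = 1 := Matrix.mem_unitaryGroup_iff'.1 hU
    simp [Matrix.mulVec_mulVec, hUU]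
  · have hUU : U * Uᴴ = 1 := Matrix.mem_unitaryGroup_iff.1 hU
    simp [Matrix.mulVec_mulVec, hUU]

theorem theorem3p3 (n : ℕ) (hn : 3 ≤ n) (φ : ProjMat n → ProjMat n)
    (hφ : Function.Bijective φ)
    (hcomm : ∀ P Q : ProjMat n,
      P.1 * Q.1 = Q.1 * P.1 ↔ (φ P).1 * (φ Q).1 = (φ Q).1 * (φ P).1) :
    ∃ U ∈ Matrix.unitaryGroup (Fin n) ℂ,
      (∀ P : ProjMat n,
        Subtype.val '' (φ '' {P, P.compl}) = {U * P.1 * Uᴴ, 1 - U * P.1 * Uᴴ}) ∨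
      (∀ P : ProjMat n,
        Subtype.val '' (φ '' {P, P.compl}) = {U * P.1ᵀ * Uᴴ, 1 - U * P.1ᵀ * Uᴴ}) := by
  obtain ⟨F, hF0, hF, horth⟩ := ProjMat.exists_lineMap hn hφ.2 hcomm
  obtain ⟨U, hU, hFU⟩ := exists_unitary_of_preserves_orthogonality hn F hF0 horth
  have hbij := Matrix.mulVec_bijective_of_mem_unitaryGroup hU
  refine ⟨U, hU, hFU.imp (fun h P => ?_) (fun h P => ?_)⟩
  · rw [ProjMat.image_pair_eq hn hφ hcomm hF0 hF h hbij (Matrix.mulVec_zero U)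
      (ProjMat.conjUnitary_mulVec hU) (ProjMat.conjUnitary_compl hU) P, Set.image_pair]
    rfl
  · rw [ProjMat.image_pair_eq hn hφ hcomm hF0 hF h (hbij.comp star_involutive.bijective)
      (by simp) (g := fun P => ProjMat.conjUnitary hU P.transpose)
      (fun P x => by
        rw [ProjMat.conjUnitary_mulVec,
          ProjMat.transpose_mulVec_star])
      (fun P => by rw [ProjMat.transpose_compl, ProjMat.conjUnitary_compl]) P, Set.image_pair]
    rfl
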